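/- All semigroups acting on spaces are topological monoids (no identity is required of the subsemigroup $S_0$ below), and an $S$-space is a space with a continuous action of $S$. For $f:X\to\mathbb R$, $s\in S$ put $(fs)(x)=f(sx)$, and $fS_0=\{fs:s\in S_0\}$. A sequence $f_n:X\to\mathbb R$ is independent if there are $a<b$ such that for all finite disjoint $P,M\subset\mathbb N$ some $x\in X$ has $f_n(x)<a$ for $n\in P$ and $f_n(x)>b$ for $n\in M$. A uniformly bounded family of functions is tame if it contains no independent sequence; a compact Hausdorff $S$-space $X$ is tame if $fS$ is a tame family for every $f\in C(X)$. A family $F$ of functions is almost continuous if every infinite $F_1\subset F$ has an infinite subset $F_2\subset F_1$ such that each $x\in X$ is a point of continuity of all but finitely many $f\in F_2$. $\mathcal B_1(X)$ is the set of $\varphi:X\to\mathbb R$ for which preimages of open sets are $F_\sigma$. $E(G,X)$ is the closure of the set of translations $x\mapsto gx$ in $X^X$ with the product topology. A function on a discrete monoid $L$ is tame if it has the form $F\circ\gamma$ where $\gamma:L\to Y$ is an $L$-equivariant map with dense range into a tame compact $L$-space $Y$ and $F\in C(Y)$. $L$ acts on $\mathbb R^L$ by $(s\omega)(t)=\omega(ts)$.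 For a multiplicative map $h:L\to S$ and $z\in X$ the coding function is $m(f,z):L\to\mathbb R$, $s\mapsto f(h(s)z)$. **Theorem.** 1. Let $X$ be a compact metrizable $S$-space, $S_0$ a subsemigroup of $S$, and $f:X\to\mathbb R$ a bounded function such that the pointwise closure of $fS_0$ in $\mathbb R^X$ is contained in $\mathcal B_1(X)$ and $fS_0$ is almost continuous. Then $fS_0$ is a tame family. 2. Let $G$ be a topological group, $X$ a compact metrizable $G$-space and $G_0\le G$ a subgroup such that (i) $(G_0,X)$ is tame, (ii) $p^{-1}(x)$ is countable for all $p\in E(G,X)$, $x\in X$, (iii) $G_0\cap \mathrm{St}(x)$ is finite for every $x\in X$, where $\mathrm{St}(x)$ is the stabilizer of $x$ in $G$. Let $f:X\to\mathbb R$ be bounded with only finitely many points of discontinuity. Then $fG_0$ is a tame family. 3. Let $K$ be a compact metrizable group, $G_0$ a group and $h:G_0\to K$ a homomorphism of groups. Then (i)–(iii) of (2) hold for the left translation action of $K$ on itself and the subgroup $h(G_0)$. Hence for every bounded $f:K\to\mathbb R$ with finitely many points of discontinuity the family $fG_0=\{x\mapsto f(h(g)x): g\in G_0\}$ is tame. 4.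 In case (1) [resp. (2)] let $L$ be any discrete monoid and $h:L\to S$ [resp. $h:L\to G$] a multiplicative map with $h(L)\subset S_0$ [resp. $h(L)\subset G_0$]; in case (3) let $L$ be any discrete monoid mapped to $K$ by the composition of a multiplicative map $L\to G_0$ with $h$. Then for every $z\in X$ (where $X=K$ in case (3)) the coding function $m(f,z)$ is a tame function on $L$; the subshift generated by $m(f,z)$, i.e. the pointwise closure of $\{g\,m(f,z):g\in L\}$ in $\mathbb R^L$, is a tame compact $L$-system; and so is the subshift $X_f$, the pointwise closure of $\{m(f,z):z\in X\}$ in $\mathbb R^L$. -/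

import Mathlib

open Set Topology

/-- A sequence of real functions on a set is independent if, for some `a < b`, every finite pattern
of "below `a`" and "above `b`" is realised. -/
def IsIndependentSeq {X : Type*} (f : ℕ → X → ℝ) : Prop :=
  ∃ a b : ℝ, a < b ∧ ∀ P M : Finset ℕ, Disjoint P M →
    ∃ x : X, (∀ n ∈ P, f n x < a) ∧ (∀ n ∈ M, b < f n x)

/-- A tame family: uniformly bounded and containing no independent sequence. -/
def IsTameFamily {X : Type*} (F : Set (X → ℝ)) : Prop :=
  (∃ B : ℝ, ∀ f ∈ F, ∀ x, |f x| ≤ B) ∧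
    ¬ ∃ u : ℕ → X → ℝ, (∀ n, u n ∈ F) ∧ IsIndependentSeq u

/-- Points of discontinuity. -/
def discSet {X : Type*} [TopologicalSpace X] (f : X → ℝ) : Set X :=
  {x | ¬ ContinuousAt f x}

/-- Each point is a continuity point of all but finitely many members of the family. -/
def StronglyAlmostContinuous {X : Type*} [TopologicalSpace X] (F : Set (X → ℝ)) : Prop :=
  ∀ x : X, {f ∈ F | ¬ ContinuousAt f x}.Finite

/-- Each infinite subfamily has an infinite strongly almost continuous subfamily. -/
def AlmostContinuous {X : Type*} [TopologicalSpace X] (F : Set (X → ℝ)) : Prop :=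
  ∀ F₁ ⊆ F, F₁.Infinite → ∃ F₂ ⊆ F₁, F₂.Infinite ∧ StronglyAlmostContinuous F₂

/-- Countable unions of closed sets. -/
def IsFSigmaSet {X : Type*} [TopologicalSpace X] (s : Set X) : Prop :=
  ∃ C : ℕ → Set X, (∀ n, IsClosed (C n)) ∧ s = ⋃ n, C n

/-- Baire class 1: preimages of open sets are `F_σ`. -/
def IsBaireOne {X : Type*} [TopologicalSpace X] (f : X → ℝ) : Prop :=
  ∀ O : Set ℝ, IsOpen O → IsFSigmaSet (f ⁻¹' O)

/-- The family `f T = {x ↦ f (t x) : t ∈ T}`. -/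
def translates {S X : Type*} [SMul S X] (f : X → ℝ) (T : Set S) : Set (X → ℝ) :=
  (fun (t : S) (x : X) => f (t • x)) '' T

/-- The enveloping semigroup `E(S,X)`: the pointwise closure of the translations in `X → X`. -/
def envelopingSemigroup (S X : Type*) [SMul S X] [TopologicalSpace X] : Set (X → X) :=
  closure (range fun (s : S) (x : X) => s • x)

/-- `X` is a compact (Hausdorff) dynamical `S`-system and it is tame: for each continuous `f` on `X`
the orbit `f S` is a tame family. -/
structure IsTameSystem (S X : Type*) [Monoid S] [TopologicalSpace S] [TopologicalSpace X]
    [MulAction S X] : Prop where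
  compact : CompactSpace X
  hausdorff : T2Space X
  continuous_action : ContinuousSMul S X
  tame : ∀ f : C(X, ℝ), IsTameFamily (translates (f : X → ℝ) (univ : Set S))

/-- A tame function on the `S`-space `X`: it comes from an `S`-compactification `γ : X → Y`
(continuous, equivariant, with dense range) such that `(S,Y)` is tame.  The universe of `Y` is no
restriction: if `f` comes from any tame `Y`, it also comes from the factor of `Y` inside `S → ℝ`
given by `y ↦ (s ↦ F (s y))`. -/
def IsTameFunction.{u, v} (S : Type u) (X : Type v) [Monoid S] [TopologicalSpace S]
    [TopologicalSpace X] [MulAction S X] (f : X → ℝ) : Prop :=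
  ∃ (Y : Type u) (_ : TopologicalSpace Y) (_ : MulAction S Y),
    IsTameSystem S Y ∧
      ∃ γ : X → Y, Continuous γ ∧ DenseRange γ ∧ (∀ (s : S) (x : X), γ (s • x) = s • γ x) ∧
        ∃ F : C(Y, ℝ), ∀ x, f x = F (γ x)

/-- The space `ℝ^L` with the pointwise topology and the shift action `(s ω)(t) = ω (t s)`. -/
def ShiftSpace (L : Type*) : Type _ := L → ℝ

instance (L : Type*) : TopologicalSpace (ShiftSpace L) :=
  inferInstanceAs (TopologicalSpace (L → ℝ))

instance (L : Type*) [Monoid L] : MulAction L (ShiftSpace L) where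
  smul s ω := fun t : L => ω (t * s)
  one_smul ω := funext fun t : L => congrArg ω (mul_one t)
  mul_smul s s' ω := funext fun t : L => congrArg ω (mul_assoc t s s').symm

theorem ShiftSpace.continuous_smul {L : Type*} [Monoid L] (s : L) :
    Continuous fun ω : ShiftSpace L => s • ω :=
  continuous_pi fun t : L => continuous_apply (t * s)

/-- The pointwise closure of a shift-invariant set of functions, as an `L`-invariant set. -/
def closedSubshift {L : Type*} [Monoid L] (A : Set (ShiftSpace L))
    (hA : ∀ (s : L), ∀ ω ∈ A, s • ω ∈ A) : SubMulAction L (ShiftSpace L) where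
  carrier := closure A
  smul_mem' s _ hω :=
    map_mem_closure (ShiftSpace.continuous_smul s) hω fun ω' hω' => hA s ω' hω'

/-- The coding function `m(f,z) : L → ℝ`, `s ↦ f (h(s) z)`. -/
def coding {L S X : Type*} [Monoid L] [Monoid S] [MulAction S X] (h : L →ₙ* S) (f : X → ℝ)
    (z : X) : ShiftSpace L :=
  fun s : L => f (h s • z)

/-- The subshift generated by `φ : L → ℝ`: the pointwise closure of its orbit `{g φ : g ∈ L}`. -/
def orbitSubshift {L : Type*} [Monoid L] (φ : ShiftSpace L) : SubMulAction L (ShiftSpace L) :=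
  closedSubshift (range fun g : L => g • φ) (by
    rintro s _ ⟨g, rfl⟩
    exact ⟨s * g, mul_smul s g φ⟩)

/-- The subshift `X_f`: the pointwise closure of all the coding functions `m(f,z)`, `z ∈ X`. -/
def codingSubshift {L S X : Type*} [Monoid L] [Monoid S] [MulAction S X] (h : L →ₙ* S)
    (f : X → ℝ) : SubMulAction L (ShiftSpace L) :=
  closedSubshift (range fun z : X => coding h f z) (by
    rintro s _ ⟨z, rfl⟩
    refine ⟨h s • z, funext fun t : L => ?_⟩
    change f (h t • h s • z) = f (h (t * s) • z)
    rw [map_mul, mul_smul])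

/-- All codings of `f` along `h : L → S` are tame functions on `L`, the subshift generated by each
of them is tame, and so is the subshift `X_f` of all of them. -/
def HasTameCodings {L S X : Type*} [Monoid L] [TopologicalSpace L] [Monoid S] [MulAction S X]
    (h : L →ₙ* S) (f : X → ℝ) : Prop :=
  (∀ z : X, IsTameFunction L L (coding h f z)) ∧
    (∀ z : X, IsTameSystem L (orbitSubshift (coding h f z))) ∧
    IsTameSystem L (codingSubshift h f)

/-! Both tameness criteria start from an independent sequence of translates of `f`. Almost
continuity in the first case, finite stabilisers and finite discontinuity set in the second, make
its terms eventually continuous at each point, possibly after passing to a subsequence. Compactness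
then upgrades independence to infinite patterns: for every `A ⊆ ℕ` some point has value `≤ a` at all
but finitely many `n ∈ A` and `≥ b` at all but finitely many `n ∉ A`
(`IsIndependentSeq.exists_pattern`).

In the Baire class 1 case, let `φ` be the limit of the sequence along a nonprincipal ultrafilter. At
a point realising `A`, `φ ≤ a` or `φ ≥ b` according to whether `A` is in the ultrafilter. So the
ultrafilter and its complement are projections of Borel sets, hence Borel by Suslin's theorem,
although a nonprincipal ultrafilter lacks the Baire property.

In the case of finitely many discontinuities, realising all patterns excludes a pointwise convergent
subsequence. But tameness and Rosenthal's dichotomy make a subsequence of the translations converge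
to some `p` in the enveloping semigroup. Along it the translates of `f` converge off the countable
preimage under `p` of the discontinuities, and a further subsequence converges there too. For a
compact group the enveloping semigroup consists of translations and the action is free.

For the subshifts, coordinates restricted to codings are translates of `f`. Independence is an open
condition, so it passes from the closure back to the codings, and Stone–Weierstrass extends its
absence from coordinates to all continuous functions. -/

open Filter

/-! ### Diagonal subsequences and Rosenthal's dichotomy -/

/-- Diagonalisation over infinite subsets of `ℕ`. -/
theorem exists_strictMono_diagonal {M₀ : Set ℕ} (hM₀ : M₀.Infinite) (Q : ℕ → ℕ → Set ℕ → Prop)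
    (h : ∀ k, ∀ n ∈ M₀, ∀ M ⊆ M₀, M.Infinite → ∃ N ⊆ M, N.Infinite ∧ Q k n N) :
    ∃ φ : ℕ → ℕ, StrictMono φ ∧ (∀ k, φ k ∈ M₀) ∧
      ∀ k, ∃ N, Q k (φ k) N ∧ ∀ i, k < i → φ i ∈ N := by
  have step : ∀ (k : ℕ) (M : {M : Set ℕ // M ⊆ M₀ ∧ M.Infinite}),
      ∃ (n : ℕ) (N : {M : Set ℕ // M ⊆ M₀ ∧ M.Infinite}),
        n ∈ M.1 ∧ N.1 ⊆ M.1 ∩ Ioi n ∧ Q k n N.1 := by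
    rintro k ⟨M, hM, hinf⟩
    obtain ⟨n, hn⟩ := hinf.nonempty
    have hinf' : (M ∩ Ioi n).Infinite := by
      have : M ∩ Ioi n = M \ Iic n := by ext; simp
      rw [this]
      exact hinf.sdiff (finite_Iic n)
    obtain ⟨N, hN, hNinf, hQ⟩ :=
      h k n (hM hn) (M ∩ Ioi n) (inter_subset_left.trans hM) hinf'
    exact ⟨n, ⟨N, hN.trans (inter_subset_left.trans hM), hNinf⟩, hn, hN, hQ⟩
  choose pt next hpt hnext hQ using step
  let st : ℕ → {M : Set ℕ // M ⊆ M₀ ∧ M.Infinite} :=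
    fun k => Nat.rec ⟨M₀, Subset.rfl, hM₀⟩ (fun k M => next k M) k
  have hanti : ∀ k i, k ≤ i → (st i).1 ⊆ (st k).1 := by
    intro k i hki
    induction hki with
    | refl => exact Subset.rfl
    | step _ ih => exact ((hnext _ _).trans inter_subset_left).trans ih
  have hmem : ∀ k i, k < i → pt i (st i) ∈ (st (k + 1)).1 := fun k i hki =>
    hanti (k + 1) i hki (hpt i (st i))
  refine ⟨fun k => pt k (st k), ?_, fun k => (st k).2.1 (hpt k (st k)), fun k => ?_⟩
  · exact strictMono_nat_of_lt_succ fun k =>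
      (hnext k (st k) (hmem k (k + 1) (Nat.lt_succ_self k))).2
  · exact ⟨(st (k + 1)).1, hQ k (st k), hmem k⟩

/-- Along `M`, every point of `Y` lies in only finitely many `C true n`, or only finitely many
`C false n`. -/
def PairConvergesOn {X : Type*} (C : Bool → ℕ → Set X) (M : Set ℕ) (Y : Set X) : Prop :=
  ∀ x ∈ Y, ∃ ε, {n ∈ M | x ∈ C ε n}.Finite

/-- No infinite subset of `M` makes the pairs converge on `Y`. -/
def PairDivergesOn {X : Type*} (C : Bool → ℕ → Set X) (M : Set ℕ) (Y : Set X) : Prop :=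
  ∀ N ⊆ M, N.Infinite → ¬ PairConvergesOn C N Y

theorem PairDivergesOn.mono {X : Type*} {C : Bool → ℕ → Set X} {M N : Set ℕ} {Y : Set X}
    (h : PairDivergesOn C M Y) (hN : N ⊆ M) : PairDivergesOn C N Y :=
  fun N' hN' => h N' (hN'.trans hN)

theorem PairDivergesOn.nonempty {X : Type*} {C : Bool → ℕ → Set X} {M : Set ℕ} {Y : Set X}
    (h : PairDivergesOn C M Y) (hM : M.Infinite) : Y.Nonempty := by
  by_contra hY
  rw [not_nonempty_iff_eq_empty] at hY
  subst hY
  exact h M Subset.rfl hM fun x hx => hx.elim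

/-- The splitting step of Rosenthal's dichotomy. -/
theorem PairDivergesOn.exists_split {X : Type*} {C : Bool → ℕ → Set X} {M : Set ℕ}
    (hM : M.Infinite) {T : Set (Set X)} (hT : T.Finite) (h : ∀ Y ∈ T, PairDivergesOn C M Y) :
    ∃ j ∈ M, ∃ N ⊆ M, N.Infinite ∧ ∀ Y ∈ T, ∀ ε, PairDivergesOn C N (Y ∩ C ε j) := by
  by_contra! hcon
  obtain ⟨φ, hφ, hφM, hφN⟩ := exists_strictMono_diagonal hM
    (fun _ n N => ∃ Y : T, ∃ ε, PairConvergesOn C N (Y.1 ∩ C ε n)) (by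
      intro k n hn M' hM' hinf
      obtain ⟨Y, hY, ε, hdiv⟩ := hcon n hn M' hM' hinf
      unfold PairDivergesOn at hdiv
      push Not at hdiv
      obtain ⟨N, hN, hNinf, hconv⟩ := hdiv
      exact ⟨N, hN, hNinf, ⟨Y, hY⟩, ε, hconv⟩)
  choose N hN hmem using hφN
  choose Y ε hconv using hN
  have : Finite T := hT
  obtain ⟨⟨Y₀, ε₀⟩, hfib⟩ := Finite.exists_infinite_fiber fun k => (Y k, ε k)
  -- Only finitely many labels `(Y, ε)` occur, so one recurs infinitely often. Along these indices
  -- the pairs will converge on all of `Y₀`: a point meeting some `C ε₀ (φ k)` is handled by `N k`,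
  -- and any other point lies in no `C ε₀ (φ i)`.
  set I : Set ℕ := (fun k => (Y k, ε k)) ⁻¹' {(Y₀, ε₀)} with hI
  have hIinf : I.Infinite := Set.infinite_coe_iff.mp hfib
  refine h Y₀.1 Y₀.2 (φ '' I) ?_ (hIinf.image hφ.injective.injOn) ?_
  · rintro _ ⟨k, -, rfl⟩
    exact hφM k
  intro x hx
  by_cases hk : ∃ k ∈ I, x ∈ C ε₀ (φ k)
  · obtain ⟨k, hkI, hxk⟩ := hk
    have hYk : Y k = Y₀ ∧ ε k = ε₀ := by simpa [hI] using hkI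
    obtain ⟨δ, hδ⟩ := hconv k x (by rw [hYk.1, hYk.2]; exact ⟨hx, hxk⟩)
    refine ⟨δ, (hδ.union ((finite_Iic k).image φ)).subset ?_⟩
    rintro _ ⟨⟨i, -, rfl⟩, hxi⟩
    rcases le_or_gt i k with hik | hik
    · exact Or.inr ⟨i, hik, rfl⟩
    · exact Or.inl ⟨hmem k i hik, hxi⟩
  · refine ⟨ε₀, Set.finite_empty.subset ?_⟩
    rintro _ ⟨⟨i, hi, rfl⟩, hxi⟩
    exact hk ⟨i, hi, hxi⟩

/-- Rosenthal's dichotomy for pairs of sets: a sequence of pairs without convergent subsequence has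
an independent subsequence. -/
theorem PairDivergesOn.exists_independent {X : Type*} {C : Bool → ℕ → Set X} {M : Set ℕ}
    (hM : M.Infinite) (h : PairDivergesOn C M univ) :
    ∃ j : ℕ → ℕ, Function.Injective j ∧ (∀ k, j k ∈ M) ∧
      ∀ (ε : ℕ → Bool) (n : ℕ), ∃ x, ∀ k < n, x ∈ C (ε k) (j k) := by
  -- A state holds the infinite index set still available and the finite collection of all cells cut
  -- out so far. Keeping every cell divergent keeps it nonempty.
  let State := {p : Set ℕ × Set (Set X) //
    p.1 ⊆ M ∧ p.1.Infinite ∧ p.2.Finite ∧ ∀ Y ∈ p.2, PairDivergesOn C p.1 Y}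
  have step : ∀ p : State, ∃ (j : ℕ) (q : State), j ∈ M ∧ q.1.1 ⊆ Ioi j ∧ q.1.1 ⊆ p.1.1 ∧
      j ∈ p.1.1 ∧ ∀ Y ∈ p.1.2, ∀ ε, Y ∩ C ε j ∈ q.1.2 := by
    rintro ⟨⟨M', T⟩, hM', hinf, hT, hdiv⟩
    obtain ⟨j, hj, N, hN, hNinf, hNdiv⟩ := PairDivergesOn.exists_split hinf hT hdiv
    have hinf' : (N ∩ Ioi j).Infinite := by
      have : N ∩ Ioi j = N \ Iic j := by ext; simp
      rw [this]
      exact hNinf.sdiff (finite_Iic j)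
    refine ⟨j, ⟨⟨N ∩ Ioi j, ⋃ ε, (fun Y => Y ∩ C ε j) '' T⟩,
      (inter_subset_left.trans hN).trans hM', hinf', finite_iUnion fun ε => hT.image _, ?_⟩,
      hM' hj, inter_subset_right, inter_subset_left.trans hN, hj, ?_⟩
    · intro Z hZ
      obtain ⟨ε, Y, hY, rfl⟩ := mem_iUnion.mp hZ
      exact (hNdiv Y hY ε).mono inter_subset_left
    · intro Y hY ε
      exact mem_iUnion.mpr ⟨ε, Y, hY, rfl⟩
  choose pt next hptM hgt hsub hpt hsplit using step
  let st : ℕ → State := fun k => Nat.rec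
    ⟨⟨M, {univ}⟩, Subset.rfl, hM, finite_singleton _, by rintro _ rfl; exact h⟩
    (fun _ p => next p) k
  refine ⟨fun k => pt (st k), ?_, fun k => hptM _, fun ε n => ?_⟩
  · exact (strictMono_nat_of_lt_succ fun k => hgt (st k) (hpt (st (k + 1)))).injective
  · have key : ∀ n, ∃ Y ∈ (st n).1.2, ∀ x ∈ Y, ∀ k < n, x ∈ C (ε k) (pt (st k)) := by
      intro n
      induction n with
      | zero => exact ⟨univ, rfl, fun x _ k hk => absurd hk (Nat.not_lt_zero k)⟩
      | succ n ih =>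
        obtain ⟨Y, hY, hx⟩ := ih
        refine ⟨Y ∩ C (ε n) (pt (st n)), hsplit (st n) Y hY (ε n), fun x hxY k hk => ?_⟩
        rcases Nat.lt_succ_iff_lt_or_eq.mp hk with hk | rfl
        · exact hx x hxY.1 k hk
        · exact hxY.2
    obtain ⟨Y, hY, hx⟩ := key n
    obtain ⟨x, hxY⟩ := ((st n).2.2.2.2 Y hY).nonempty (st n).2.2.1
    exact ⟨x, hx x hxY⟩

/-- Rosenthal's dichotomy: a uniformly bounded sequence of real functions none of whose subsequences
is independent has a pointwise convergent subsequence. -/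
theorem exists_subseq_tendsto_of_forall_not_independent {X : Type*} {u : ℕ → X → ℝ} {B : ℝ}
    (hB : ∀ n x, |u n x| ≤ B)
    (hu : ∀ φ : ℕ → ℕ, Function.Injective φ → ¬ IsIndependentSeq fun n => u (φ n)) :
    ∃ φ : ℕ → ℕ, StrictMono φ ∧ ∀ x, ∃ l, Tendsto (fun n => u (φ n) x) atTop (𝓝 l) := by
  obtain ⟨e, he⟩ := exists_surjective_nat (ℚ × ℚ)
  let C : ℚ × ℚ → Bool → ℕ → Set X := fun q ε n =>
    if ε then {x | u n x < q.1} else {x | (q.2 : ℝ) < u n x}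
  obtain ⟨φ, hφ, -, hφN⟩ := exists_strictMono_diagonal infinite_univ
    (fun k _ N => (e k).1 < (e k).2 → PairConvergesOn (C (e k)) N univ) (by
      intro k n _ M _ hM
      by_contra! hcon
      have hdiv : PairDivergesOn (C (e k)) M univ := fun N hN hinf => (hcon N hN hinf).2
      obtain ⟨j, hj, -, hind⟩ := hdiv.exists_independent hM
      refine hu j hj ⟨(e k).1, (e k).2, by exact_mod_cast (hcon M Subset.rfl hM).1,
        fun P N hPN => ?_⟩
      classical
      obtain ⟨m, hm⟩ := (P ∪ N).exists_nat_subset_range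
      obtain ⟨x, hx⟩ := hind (fun i => decide (i ∈ P)) m
      refine ⟨x, fun i hi => ?_, fun i hi => ?_⟩
      · have := hx i (Finset.mem_range.mp (hm (Finset.mem_union_left _ hi)))
        simpa [C, hi] using this
      · have := hx i (Finset.mem_range.mp (hm (Finset.mem_union_right _ hi)))
        simpa [C, Finset.disjoint_right.mp hPN hi] using this)
  refine ⟨φ, hφ, fun x => ?_⟩
  -- It suffices to exclude oscillation across rational `a < b`. The tail of `φ` lies in the set `N`
  -- chosen for that pair.
  refine tendsto_of_no_upcrossings Rat.isDenseEmbedding_coe_real.dense ?_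
    (isBoundedUnder_of ⟨B, fun n => (abs_le.mp (hB _ x)).2⟩)
    (isBoundedUnder_of ⟨-B, fun n => (abs_le.mp (hB _ x)).1⟩)
  rintro _ ⟨a, rfl⟩ _ ⟨b, rfl⟩ hab ⟨ha, hb⟩
  obtain ⟨k, hk⟩ := he (a, b)
  obtain ⟨N, hN, hmem⟩ := hφN k
  rw [hk] at hN
  obtain ⟨ε, hε⟩ := hN (by exact_mod_cast hab) x (mem_univ x)
  have hfin : {i | x ∈ C (a, b) ε (φ i)}.Finite := by
    refine ((hε.preimage hφ.injective.injOn).union (finite_Iic k)).subset fun i hi => ?_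
    rcases le_or_gt i k with hik | hik
    · exact Or.inr hik
    · exact Or.inl ⟨hmem i hik, hi⟩
  cases ε
  · exact Nat.frequently_atTop_iff_infinite.mp hb (by simpa [C] using hfin)
  · exact Nat.frequently_atTop_iff_infinite.mp ha (by simpa [C] using hfin)

/-! ### Independent sequences on compact spaces -/

theorem IsIndependentSeq.comp_injective {X : Type*} {u : ℕ → X → ℝ} (hu : IsIndependentSeq u)
    {φ : ℕ → ℕ} (hφ : Function.Injective φ) : IsIndependentSeq fun n => u (φ n) := by
  obtain ⟨a, b, hab, h⟩ := hu
  refine ⟨a, b, hab, fun P M hPM => ?_⟩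
  obtain ⟨x, hP, hM⟩ := h (P.map ⟨φ, hφ⟩) (M.map ⟨φ, hφ⟩) ((Finset.disjoint_map _).mpr hPM)
  exact ⟨x, fun n hn => hP _ (Finset.mem_map_of_mem ⟨φ, hφ⟩ hn),
    fun n hn => hM _ (Finset.mem_map_of_mem ⟨φ, hφ⟩ hn)⟩

theorem IsIndependentSeq.injective {X : Type*} {u : ℕ → X → ℝ} (hu : IsIndependentSeq u) :
    Function.Injective u := by
  obtain ⟨a, b, hab, h⟩ := hu
  intro m n hmn
  by_contra hne
  obtain ⟨x, hx, hy⟩ := h {m} {n} (by simpa using hne)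
  have h1 := hx m (by simp)
  have h2 := hy n (by simp)
  rw [hmn] at h1
  linarith

/-- On a compact space, an independent sequence of functions each point of which is a continuity
point of almost all of them realises every infinite pattern up to finitely many terms. -/
theorem IsIndependentSeq.exists_pattern {X : Type*} [TopologicalSpace X] [CompactSpace X]
    {u : ℕ → X → ℝ} (hu : IsIndependentSeq u)
    (hcont : ∀ x, ∀ᶠ n in atTop, ContinuousAt (u n) x) :
    ∃ a b : ℝ, a < b ∧ ∀ A : Set ℕ, ∃ x, ∀ᶠ n in atTop,
      (n ∈ A → u n x ≤ a) ∧ (n ∉ A → b ≤ u n x) := by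
  classical
  obtain ⟨a, b, hab, h⟩ := hu
  refine ⟨a, b, hab, fun A => ?_⟩
  have hfin : ∀ m : ℕ, ∃ x, ∀ n < m, (n ∈ A → u n x < a) ∧ (n ∉ A → b < u n x) := by
    intro m
    obtain ⟨x, hP, hM⟩ := h ((Finset.range m).filter (· ∈ A)) ((Finset.range m).filter (· ∉ A))
      (Finset.disjoint_filter_filter_not _ _ _)
    exact ⟨x, fun n hn => ⟨fun hA => hP n (by simp [hn, hA]), fun hA => hM n (by simp [hn, hA])⟩⟩
  choose y hy using hfin
  -- A cluster point of the finite-pattern witnesses inherits the weak inequality for each `u n`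
  -- continuous at it.
  obtain ⟨x, -, hx⟩ := isCompact_univ.exists_mapClusterPt (f := atTop) (u := y) (by simp)
  refine ⟨x, (hcont x).mono fun n hn => ?_⟩
  have hcl : MapClusterPt (u n x) atTop fun m => u n (y m) := hx.tendsto_comp hn
  refine ⟨fun hA => ?_, fun hA => ?_⟩
  · refine isClosed_Iic.mem_of_mapClusterPt hcl ?_
    filter_upwards [eventually_gt_atTop n] with m hm using ((hy m n hm).1 hA).le
  · refine isClosed_Ici.mem_of_mapClusterPt hcl ?_
    filter_upwards [eventually_gt_atTop n] with m hm using ((hy m n hm).2 hA).le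

/-- Alternate the pattern along `φ`: a limit at the realising point would be both `≤ a` and `≥ b`.
-/
theorem IsIndependentSeq.not_forall_exists_tendsto {X : Type*} [TopologicalSpace X] [CompactSpace X]
    {u : ℕ → X → ℝ} (hu : IsIndependentSeq u)
    (hcont : ∀ x, ∀ᶠ n in atTop, ContinuousAt (u n) x) {φ : ℕ → ℕ} (hφ : StrictMono φ) :
    ¬ ∀ x, ∃ l, Tendsto (fun n => u (φ n) x) atTop (𝓝 l) := by
  intro hlim
  obtain ⟨a, b, hab, h⟩ := hu.exists_pattern hcont
  obtain ⟨x, hx⟩ := h {n | ∃ k, n = φ (2 * k)}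
  obtain ⟨l, hl⟩ := hlim x
  have hev : Tendsto (fun k : ℕ => 2 * k) atTop atTop :=
    tendsto_atTop_mono (fun k => by simp only [id]; omega) tendsto_id
  have hod : Tendsto (fun k : ℕ => 2 * k + 1) atTop atTop :=
    tendsto_atTop_mono (fun k => by simp only [id]; omega) tendsto_id
  have h1 : l ≤ a := le_of_tendsto (hl.comp hev) <|
    ((hφ.tendsto_atTop.comp hev).eventually hx).mono fun k hk => hk.1 ⟨k, rfl⟩
  have h2 : b ≤ l := ge_of_tendsto (hl.comp hod) <|
    ((hφ.tendsto_atTop.comp hod).eventually hx).mono fun k hk => hk.2 (by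
      rintro ⟨j, hj⟩
      have := hφ.injective hj
      simp only at this
      omega)
  linarith

/-- An independent sequence in an almost continuous family has a subsequence each point of which is
a continuity point of almost all of its terms. -/
theorem IsIndependentSeq.exists_subseq_continuousAt {X : Type*} [TopologicalSpace X]
    {u : ℕ → X → ℝ} (hu : IsIndependentSeq u) {F : Set (X → ℝ)} (hF : AlmostContinuous F)
    (huF : ∀ n, u n ∈ F) :
    ∃ φ : ℕ → ℕ, StrictMono φ ∧ ∀ x, ∀ᶠ n in atTop, ContinuousAt (u (φ n)) x := by
  obtain ⟨F₂, hF₂, hinf, hcont⟩ := hF (range u) (range_subset_iff.mpr huF)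
    (infinite_range_of_injective hu.injective)
  have hpre : (u ⁻¹' F₂).Infinite := hinf.preimage hF₂
  refine ⟨Nat.nth (· ∈ u ⁻¹' F₂), Nat.nth_strictMono hpre, fun x => ?_⟩
  have hfin : {n | ¬ ContinuousAt (u (Nat.nth (· ∈ u ⁻¹' F₂) n)) x}.Finite := by
    refine ((hcont x).preimage
      ((hu.injective.comp (Nat.nth_injective hpre)).injOn)).subset fun n hn => ?_
    exact ⟨Nat.nth_mem_of_infinite hpre n, hn⟩
  rw [← Nat.cofinite_eq_atTop]
  exact hfin

/-! ### Nonprincipal ultrafilters and Baire class 1 closures -/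

/-- A bounded real function has a limit along every ultrafilter. -/
theorem Ultrafilter.exists_tendsto_of_abs_le {ι : Type*} (p : Ultrafilter ι) {v : ι → ℝ} {B : ℝ}
    (hv : ∀ i, |v i| ≤ B) : ∃ l, Tendsto v p (𝓝 l) := by
  obtain ⟨l, -, hl⟩ := (isCompact_Icc (a := -B) (b := B)).ultrafilter_le_nhds (p.map v)
    (le_principal_iff.mpr (Filter.mem_map.mpr (Filter.univ_mem' fun i => abs_le.mp (hv i))))
  exact ⟨l, hl⟩

/-- A nonprincipal ultrafilter is not Borel in the Cantor space. -/
theorem not_measurableSet_hyperfilter :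
    ¬ MeasurableSet {A : ℕ → Bool | {n | A n = true} ∈ hyperfilter ℕ} := by
  intro hS
  set S : Set (ℕ → Bool) := {A | {n | A n = true} ∈ hyperfilter ℕ} with hSdef
  obtain ⟨U, hU, hSU⟩ := hS.residualEq_isOpen
  -- Changing all coordinates from `n` on exchanges the ultrafilter with its complement, since
  -- finitely many coordinates do not matter.
  let flip : ℕ → (ℕ → Bool) → (ℕ → Bool) := fun n A i => if i < n then A i else !(A i)
  have hflip2 : ∀ n A, flip n (flip n A) = A := by
    intro n A
    funext i
    by_cases hi : i < n <;> simp [flip, hi]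
  have hflipc : ∀ n, Continuous (flip n) := by
    intro n
    refine continuous_pi fun i => ?_
    by_cases hi : i < n
    · simpa [flip, hi] using continuous_apply i
    · simpa [flip, hi, Function.comp_def] using (continuous_of_discreteTopology (f := not)).comp (continuous_apply (A := fun _ : ℕ => Bool) i)
  have hflipS : ∀ n A, flip n A ∈ S ↔ A ∉ S := by
    intro n A
    have : ∀ᶠ i in (hyperfilter ℕ : Filter ℕ), flip n A i = true ↔ ¬ A i = true := by
      refine Filter.Eventually.filter_mono Nat.hyperfilter_le_atTop ?_
      filter_upwards [eventually_ge_atTop n] with i hi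
      simp [flip, Nat.not_lt.mpr hi]
    exact (eventually_congr this).trans Ultrafilter.eventually_not
  -- A cylinder of length `n` inside `U` is invariant under `flip n`. If `U` is empty, the whole
  -- space serves.
  obtain ⟨V, n, hV, hVne, hVU⟩ : ∃ (V : Set (ℕ → Bool)) (n : ℕ), IsOpen V ∧ V.Nonempty ∧
      ∀ A ∈ V, (A ∈ U ↔ flip n A ∈ U) := by
    rcases U.eq_empty_or_nonempty with rfl | ⟨A₀, hA₀⟩
    · exact ⟨univ, 0, isOpen_univ, ⟨fun _ => true, mem_univ _⟩, fun A _ => by simp⟩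
    · obtain ⟨_, ⟨x, n, rfl⟩, hx, hxU⟩ :=
        (PiNat.isTopologicalBasis_cylinders fun _ : ℕ => Bool).exists_subset_of_mem_open hA₀ hU
      refine ⟨PiNat.cylinder x n, n, PiNat.isOpen_cylinder _ x n, ⟨A₀, hx⟩, fun A hA => ?_⟩
      refine iff_of_true (hxU hA) (hxU fun i hi => ?_)
      simpa [flip, hi] using hA i hi
  let e : (ℕ → Bool) ≃ₜ (ℕ → Bool) :=
    { toFun := flip n, invFun := flip n, left_inv := hflip2 n, right_inv := hflip2 n
      continuous_toFun := hflipc n, continuous_invFun := hflipc n }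
  have h1 : ∀ᶠ A in residual (ℕ → Bool), A ∈ S ↔ A ∈ U := Filter.eventuallyEq_set.mp hSU
  have h2 : ∀ᶠ A in residual (ℕ → Bool), flip n A ∈ S ↔ flip n A ∈ U :=
    (tendsto_residual_of_isOpenMap e.continuous e.isOpenMap).eventually h1
  obtain ⟨A, hAV, hA1, hA2⟩ := (dense_of_mem_residual (h1.and h2)).inter_open_nonempty V hV hVne
  have := hVU A hAV
  have := hflipS n A
  tauto

theorem IsBaireOne.measurable {X : Type*} [TopologicalSpace X] [MeasurableSpace X] [BorelSpace X]
    {f : X → ℝ} (hf : IsBaireOne f) : Measurable f := by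
  refine measurable_of_isOpen fun O hO => ?_
  obtain ⟨C, hC, h⟩ := hf O hO
  rw [h]
  exact MeasurableSet.iUnion fun n => (hC n).measurableSet

/-- A uniformly bounded sequence on a compact metrizable space whose pointwise closure consists of
Baire class 1 functions cannot realise all infinite patterns. -/
theorem not_forall_exists_pattern_of_isBaireOne {X : Type*} [TopologicalSpace X] [CompactSpace X]
    [TopologicalSpace.MetrizableSpace X] {u : ℕ → X → ℝ} {B : ℝ} (hB : ∀ n x, |u n x| ≤ B)
    (hu : ∀ φ ∈ closure (range u), IsBaireOne φ) {a b : ℝ} (hab : a < b) :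
    ¬ ∀ A : Set ℕ, ∃ x, ∀ᶠ n in atTop, (n ∈ A → u n x ≤ a) ∧ (n ∉ A → b ≤ u n x) := by
  intro hpat
  let _ : MetricSpace X := TopologicalSpace.metrizableSpaceMetric X
  borelize X
  have : PolishSpace (ℕ → Bool) := by
    let _ : MetricSpace (ℕ → Bool) := TopologicalSpace.metrizableSpaceMetric _
    infer_instance
  have hlim : ∀ x, ∃ l, Tendsto (fun n => u n x) (hyperfilter ℕ : Filter ℕ) (𝓝 l) := fun x =>
    (hyperfilter ℕ).exists_tendsto_of_abs_le fun n => hB n x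
  choose φ hφ using hlim
  have hφm : Measurable φ := (hu φ (mem_closure_of_tendsto (tendsto_pi_nhds.mpr hφ)
    (Eventually.of_forall fun n => mem_range_self n))).measurable
  have hum : ∀ n, Measurable (u n) := fun n => (hu _ (subset_closure (mem_range_self n))).measurable
  let R : Set ((ℕ → Bool) × X) := {q | ∀ᶠ n in atTop,
    (q.1 n = true → u n q.2 ≤ a) ∧ (¬ q.1 n = true → b ≤ u n q.2)}
  have hR : MeasurableSet R := by
    have : R = ⋃ N, ⋂ n, ⋂ (_ : N ≤ n), {q : (ℕ → Bool) × X |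
        (q.1 n = true → u n q.2 ≤ a) ∧ (¬ q.1 n = true → b ≤ u n q.2)} := by
      ext q
      simp only [R, mem_ofPred_eq, eventually_atTop, mem_iUnion, mem_iInter]
    rw [this]
    refine MeasurableSet.iUnion fun N => MeasurableSet.iInter fun n => MeasurableSet.iInter fun _ => ?_
    have h1 : MeasurableSet {q : (ℕ → Bool) × X | q.1 n = true} :=
      measurableSet_eq_fun ((measurable_pi_apply n).comp measurable_fst) measurable_const
    have h2 : Measurable fun q : (ℕ → Bool) × X => u n q.2 := (hum n).comp measurable_snd
    exact (h1.imp (measurableSet_le h2 measurable_const)).inter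
      (h1.compl.imp (measurableSet_le measurable_const h2))
  have hval : ∀ q ∈ R, ({n | q.1 n = true} ∈ hyperfilter ℕ → φ q.2 ≤ a) ∧
      ({n | q.1 n = true} ∉ hyperfilter ℕ → b ≤ φ q.2) := by
    intro q hq
    have hq' : ∀ᶠ n in (hyperfilter ℕ : Filter ℕ),
        (q.1 n = true → u n q.2 ≤ a) ∧ (¬ q.1 n = true → b ≤ u n q.2) :=
      Filter.Eventually.filter_mono Nat.hyperfilter_le_atTop hq
    refine ⟨fun h => le_of_tendsto (hφ q.2) ?_, fun h => ge_of_tendsto (hφ q.2) ?_⟩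
    · filter_upwards [hq', h] with n hn hn' using hn.1 hn'
    · filter_upwards [hq', Ultrafilter.compl_mem_iff_notMem.mpr h] with n hn hn' using hn.2 hn'
  have hpat' : ∀ A : ℕ → Bool, ∃ x, (A, x) ∈ R := fun A => hpat {n | A n = true}
  have himage : ∀ T : Set ((ℕ → Bool) × X), MeasurableSet T →
      MeasureTheory.AnalyticSet (Prod.fst '' T) := fun T hT =>
    hT.analyticSet.image_of_continuous continuous_fst
  have hφ2 : Measurable fun q : (ℕ → Bool) × X => φ q.2 := hφm.comp measurable_snd
  -- Suslin's theorem: the ultrafilter and its complement are the projections of the parts of `R`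
  -- where `φ ≤ a` and where `b ≤ φ`.
  refine not_measurableSet_hyperfilter (MeasureTheory.AnalyticSet.measurableSet_of_compl ?_ ?_)
  · convert himage (R ∩ {q | φ q.2 ≤ a}) (hR.inter (measurableSet_le hφ2 measurable_const)) using 1
    ext A
    constructor
    · intro hA
      obtain ⟨x, hx⟩ := hpat' A
      exact ⟨(A, x), ⟨hx, (hval _ hx).1 hA⟩, rfl⟩
    · rintro ⟨q, ⟨hq, hqa⟩, rfl⟩
      by_contra hA
      exact absurd (((hval q hq).2 hA).trans hqa) (not_le.mpr hab)
  · convert himage (R ∩ {q | b ≤ φ q.2}) (hR.inter (measurableSet_le measurable_const hφ2)) using 1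
    ext A
    constructor
    · intro hA
      obtain ⟨x, hx⟩ := hpat' A
      exact ⟨(A, x), ⟨hx, (hval _ hx).2 hA⟩, rfl⟩
    · rintro ⟨q, ⟨hq, hqb⟩, rfl⟩ hA
      exact absurd (hqb.trans ((hval q hq).1 hA)) (not_le.mpr hab)

/-- A uniformly bounded almost continuous family on a compact metrizable space with pointwise closure
in the Baire class 1 functions is tame. -/
theorem AlmostContinuous.isTameFamily {X : Type*} [TopologicalSpace X] [CompactSpace X]
    [TopologicalSpace.MetrizableSpace X] {F : Set (X → ℝ)} (hF : AlmostContinuous F)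
    (hbdd : ∃ B : ℝ, ∀ f ∈ F, ∀ x, |f x| ≤ B) (hcl : ∀ φ ∈ closure F, IsBaireOne φ) :
    IsTameFamily F := by
  refine ⟨hbdd, ?_⟩
  rintro ⟨u, huF, hu⟩
  obtain ⟨B, hB⟩ := hbdd
  obtain ⟨φ, hφ, hcont⟩ := hu.exists_subseq_continuousAt hF huF
  obtain ⟨a, b, hab, hpat⟩ := (hu.comp_injective hφ.injective).exists_pattern hcont
  exact not_forall_exists_pattern_of_isBaireOne (fun n x => hB _ (huF (φ n)) x)
    (fun ψ hψ => hcl ψ (closure_mono (range_subset_iff.mpr fun n => huF (φ n)) hψ)) hab hpat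

/-! ### Stone–Weierstrass and tame subshifts -/

/-- The continuous functions on `Y` each sequence of translates of which has a pointwise convergent
subsequence. -/
def convergentTranslatesSubalgebra (S Y : Type*) [SMul S Y] [TopologicalSpace Y] :
    Subalgebra ℝ C(Y, ℝ) where
  carrier := {F | ∀ s : ℕ → S, ∃ φ : ℕ → ℕ, StrictMono φ ∧
    ∀ y, ∃ l, Tendsto (fun n => F (s (φ n) • y)) atTop (𝓝 l)}
  algebraMap_mem' r s := ⟨id, strictMono_id, fun _ => ⟨r, tendsto_const_nhds⟩⟩
  add_mem' {F F'} hF hF' s := by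
    obtain ⟨φ, hφ, h⟩ := hF s
    obtain ⟨ψ, hψ, h'⟩ := hF' (s ∘ φ)
    refine ⟨φ ∘ ψ, hφ.comp hψ, fun y => ?_⟩
    obtain ⟨l, hl⟩ := h y
    obtain ⟨l', hl'⟩ := h' y
    exact ⟨l + l', (hl.comp hψ.tendsto_atTop).add hl'⟩
  mul_mem' {F F'} hF hF' s := by
    obtain ⟨φ, hφ, h⟩ := hF s
    obtain ⟨ψ, hψ, h'⟩ := hF' (s ∘ φ)
    refine ⟨φ ∘ ψ, hφ.comp hψ, fun y => ?_⟩
    obtain ⟨l, hl⟩ := h y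
    obtain ⟨l', hl'⟩ := h' y
    exact ⟨l * l', (hl.comp hψ.tendsto_atTop).mul hl'⟩

theorem mem_convergentTranslatesSubalgebra_of_not_independent {S Y : Type*} [SMul S Y]
    [TopologicalSpace Y] [CompactSpace Y] {F : C(Y, ℝ)}
    (h : ∀ s : ℕ → S, ¬ IsIndependentSeq fun n y => F (s n • y)) :
    F ∈ convergentTranslatesSubalgebra S Y := fun s =>
  exists_subseq_tendsto_of_forall_not_independent (u := fun n y => F (s n • y)) (B := ‖F‖)
    (fun _ _ => F.norm_coe_le_norm _) fun φ _ => h (s ∘ φ)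

theorem not_independent_of_mem_convergentTranslatesSubalgebra {S Y : Type*} [SMul S Y]
    [TopologicalSpace Y] [CompactSpace Y] [ContinuousConstSMul S Y] {F : C(Y, ℝ)}
    (hF : F ∈ convergentTranslatesSubalgebra S Y) (s : ℕ → S) :
    ¬ IsIndependentSeq fun n y => F (s n • y) := by
  intro hind
  obtain ⟨φ, hφ, h⟩ := hF s
  exact hind.not_forall_exists_tendsto (fun x => Eventually.of_forall fun n =>
    (F.continuous.comp (continuous_const_smul (s n))).continuousAt) hφ h

/-- Independence survives a uniform perturbation smaller than half the gap, which lets it pass to a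
dense subalgebra. -/
theorem IsIndependentSeq.of_dist_le {X : Type*} {u v : ℕ → X → ℝ} {a b ε : ℝ}
    (hab : a + ε < b - ε)
    (h : ∀ P M : Finset ℕ, Disjoint P M → ∃ x, (∀ n ∈ P, u n x < a) ∧ (∀ n ∈ M, b < u n x))
    (huv : ∀ n x, |u n x - v n x| ≤ ε) : IsIndependentSeq v := by
  refine ⟨a + ε, b - ε, hab, fun P M hPM => ?_⟩
  obtain ⟨x, hP, hM⟩ := h P M hPM
  refine ⟨x, fun n hn => ?_, fun n hn => ?_⟩
  · linarith [hP n hn, (abs_le.mp (huv n x)).1]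
  · linarith [hM n hn, (abs_le.mp (huv n x)).2]

/-- If point-separating continuous functions have translates without independent sequences, then so
do all continuous functions. -/
theorem not_independent_of_separatesPoints {S Y : Type*} [SMul S Y]
    [TopologicalSpace Y] [CompactSpace Y] [ContinuousConstSMul S Y]
    (hsep : (convergentTranslatesSubalgebra S Y).SeparatesPoints) (F : C(Y, ℝ)) (s : ℕ → S) :
    ¬ IsIndependentSeq fun n y => F (s n • y) := by
  rintro ⟨a, b, hab, h⟩
  have hF : F ∈ (convergentTranslatesSubalgebra S Y).topologicalClosure := by
    rw [ContinuousMap.subalgebra_topologicalClosure_eq_top_of_separatesPoints _ hsep]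
    trivial
  obtain ⟨F', hF', hdist⟩ := Metric.mem_closure_iff.mp hF ((b - a) / 3) (by linarith)
  refine not_independent_of_mem_convergentTranslatesSubalgebra hF' s
    (IsIndependentSeq.of_dist_le (ε := (b - a) / 3) (by linarith) h fun n y => ?_)
  rw [← Real.dist_eq]
  exact (ContinuousMap.dist_apply_le_dist _).trans hdist.le

/-- A bounded subshift is tame as soon as the coordinates have no independent sequence on a dense
subset. -/
theorem isTameSystem_closedSubshift {L : Type*} [Monoid L] [TopologicalSpace L]
    [DiscreteTopology L] {A : Set (ShiftSpace L)} (hA : ∀ (s : L), ∀ ω ∈ A, s • ω ∈ A) {B : ℝ}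
    (hB : ∀ ω ∈ A, ∀ t : L, |(ω : L → ℝ) t| ≤ B)
    (hind : ∀ s : ℕ → L, ¬ IsIndependentSeq fun n (ω : A) => (ω.1 : L → ℝ) (s n)) :
    IsTameSystem L (closedSubshift A hA) := by
  have hcoe : ∀ t : L, Continuous fun ω : ShiftSpace L => (ω : L → ℝ) t := fun t =>
    continuous_apply (A := fun _ : L => ℝ) t
  have hsub : closure A ⊆ univ.pi fun _ : L => Icc (-B) B :=
    closure_minimal (fun ω hω t _ => abs_le.mp (hB ω hω t))
      (isClosed_set_pi (s := fun _ : L => Icc (-B) B) fun _ _ => isClosed_Icc)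
  have hcomp : IsCompact (closure A) :=
    (isCompact_univ_pi (X := fun _ : L => ℝ) (s := fun _ => Icc (-B) B)
      fun _ => isCompact_Icc).of_isClosed_subset isClosed_closure hsub
  have hY : CompactSpace (closedSubshift A hA) := isCompact_iff_compactSpace.mp hcomp
  have hT2 : T2Space (ShiftSpace L) := inferInstanceAs (T2Space (L → ℝ))
  have hcs : ContinuousSMul L (closedSubshift A hA) := by
    refine ⟨continuous_prod_of_discrete_left.mpr fun s => ?_⟩
    exact ((ShiftSpace.continuous_smul s).comp continuous_subtype_val).subtype_mk _
  let ev : L → C(closedSubshift A hA, ℝ) := fun t =>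
    ⟨fun ω => (ω.1 : L → ℝ) t, (hcoe t).comp continuous_subtype_val⟩
  have hev : ∀ t, ev t ∈ convergentTranslatesSubalgebra L (closedSubshift A hA) := by
    refine fun t => mem_convergentTranslatesSubalgebra_of_not_independent fun s => ?_
    rintro ⟨a, b, hab, h⟩
    -- Evaluating `s n • ω` at `t` reads the coordinate `t * s n`. Each finite pattern is an open
    -- condition, so it is already met in `A`.
    refine hind (fun n => t * s n) ⟨a, b, hab, fun P M hPM => ?_⟩
    obtain ⟨⟨ω, hω⟩, hP, hM⟩ := h P M hPM
    let V : Set (ShiftSpace L) := (⋂ n ∈ P, {ω | (ω : L → ℝ) (t * s n) < a}) ∩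
      ⋂ n ∈ M, {ω | b < (ω : L → ℝ) (t * s n)}
    have hV : IsOpen V :=
      (isOpen_biInter_finset fun n _ => isOpen_lt (hcoe _) continuous_const).inter
        (isOpen_biInter_finset fun n _ => isOpen_lt continuous_const (hcoe _))
    have hωV : ω ∈ V := ⟨mem_iInter₂.mpr fun n hn => hP n hn, mem_iInter₂.mpr fun n hn => hM n hn⟩
    obtain ⟨ω', hV', hA'⟩ := mem_closure_iff.mp hω V hV hωV
    exact ⟨⟨ω', hA'⟩, fun n hn => mem_iInter₂.mp hV'.1 n hn,
      fun n hn => mem_iInter₂.mp hV'.2 n hn⟩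
  have hsep : (convergentTranslatesSubalgebra L (closedSubshift A hA)).SeparatesPoints := by
    intro ω ω' hne
    obtain ⟨t, ht⟩ : ∃ t : L, (ω.1 : L → ℝ) t ≠ (ω'.1 : L → ℝ) t := by
      by_contra! hcon
      exact hne (Subtype.ext (funext hcon))
    exact ⟨ev t, ⟨ev t, hev t, rfl⟩, ht⟩
  refine ⟨hY, inferInstance, hcs, fun F => ⟨⟨‖F‖, ?_⟩, ?_⟩⟩
  · rintro _ ⟨s, -, rfl⟩ y
    exact F.norm_coe_le_norm _
  · rintro ⟨u, hu, hui⟩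
    choose s _ hs using hu
    have : u = fun n y => F (s n • y) := funext fun n => (hs n).symm
    rw [this] at hui
    exact not_independent_of_separatesPoints hsep F s hui

/-- The coordinate `s n` at `m(f,z)` is the translate of `f` by `h (s n)` evaluated at `z`, so
independent coordinates would give independent translates. -/
theorem hasTameCodings_of_isTameFamily {L S X : Type*} [Monoid L] [TopologicalSpace L]
    [DiscreteTopology L] [Monoid S] [MulAction S X] {S₀ : Set S} {f : X → ℝ}
    (hf : IsTameFamily (translates f S₀)) (h : L →ₙ* S) (hh : ∀ l, h l ∈ S₀) :
    HasTameCodings h f := by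
  obtain ⟨⟨B, hB⟩, hind⟩ := hf
  have hbd : ∀ (t : L) (z : X), |f (h t • z)| ≤ B := fun t z => hB _ ⟨h t, hh t, rfl⟩ z
  have hcod : ∀ (s : ℕ → L) (A : Set (ShiftSpace L)), (∀ ω ∈ A, ∃ z, coding h f z = ω) →
      ¬ IsIndependentSeq fun n (ω : A) => (ω.1 : L → ℝ) (s n) := by
    rintro s A hA ⟨a, b, hab, hPM⟩
    refine hind ⟨fun n x => f (h (s n) • x), fun n => ⟨h (s n), hh _, rfl⟩, a, b, hab,
      fun P M hd => ?_⟩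
    obtain ⟨⟨ω, hω⟩, hP, hM⟩ := hPM P M hd
    obtain ⟨z, rfl⟩ := hA ω hω
    exact ⟨z, hP, hM⟩
  have horb : ∀ z : X, IsTameSystem L (orbitSubshift (coding h f z)) := by
    intro z
    have hmem : ∀ ω ∈ range (fun g : L => g • coding h f z), ∃ z', coding h f z' = ω := by
      rintro _ ⟨g, rfl⟩
      refine ⟨h g • z, funext fun t : L => ?_⟩
      change f (h t • h g • z) = f (h (t * g) • z)
      rw [map_mul, mul_smul]
    refine isTameSystem_closedSubshift (B := B) _ (fun ω hω t => ?_) fun s => hcod s _ hmem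
    obtain ⟨z', rfl⟩ := hmem ω hω
    exact hbd t z'
  refine ⟨fun z => ?_, horb, ?_⟩
  -- The compactification is the orbit map, and `F` is evaluation at `1`. Only `1 * t = t` in `L` is
  -- needed, so `h` need not preserve the identity.
  · refine ⟨orbitSubshift (coding h f z), inferInstance, inferInstance, horb z,
      fun g => ⟨g • coding h f z, subset_closure ⟨g, rfl⟩⟩, continuous_of_discreteTopology, ?_,
      fun s x => Subtype.ext (mul_smul s x (coding h f z)),
      ⟨fun ω => (ω.1 : L → ℝ) 1, (continuous_apply (A := fun _ : L => ℝ) 1).comp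
        continuous_subtype_val⟩, fun t => ?_⟩
    · rw [DenseRange, dense_iff_closure_eq, eq_univ_iff_forall]
      rintro ⟨ω, hω⟩
      rw [closure_subtype, ← range_comp]
      exact hω
    · change f (h t • z) = f (h (1 * t) • z)
      rw [one_mul]
  · refine isTameSystem_closedSubshift (B := B) _ ?_ fun s => hcod s _ fun ω hω => hω
    rintro _ ⟨z, rfl⟩ t
    exact hbd t z

/-! ### Tame metrizable systems and functions with finitely many discontinuities -/

/-- Expresses convergence along a subsequence through its index set, the form the diagonal argument
requires. -/
theorem tendsto_atTop_inf_principal_range {α : Type*} {φ : ℕ → ℕ} (hφ : StrictMono φ)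
    {v : ℕ → α} {l : Filter α} (h : Tendsto (fun n => v (φ n)) atTop l) :
    Tendsto v (atTop ⊓ 𝓟 (range φ)) l := by
  rw [← map_comap, ← Nat.cofinite_eq_atTop, hφ.injective.comap_cofinite_eq, Nat.cofinite_eq_atTop,
    tendsto_map'_iff]
  exact h

/-- In a tame metrizable system every sequence of translations has a pointwise convergent
subsequence. -/
theorem IsTameSystem.exists_subseq_tendsto_smul {S X : Type*} [Monoid S] [TopologicalSpace S]
    [TopologicalSpace X] [TopologicalSpace.MetrizableSpace X] [MulAction S X]
    (h : IsTameSystem S X) (g : ℕ → S) :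
    ∃ φ : ℕ → ℕ, StrictMono φ ∧ ∃ p : X → X, ∀ x,
      Tendsto (fun n => g (φ n) • x) atTop (𝓝 (p x)) := by
  have := h.compact
  let _ : MetricSpace X := TopologicalSpace.metrizableSpaceMetric X
  rcases isEmpty_or_nonempty X with hX | hX
  · exact ⟨id, strictMono_id, id, fun x => (hX.false x).elim⟩
  let d := TopologicalSpace.denseSeq X
  have hd : DenseRange d := TopologicalSpace.denseRange_denseSeq X
  obtain ⟨φ, hφ, -, hN⟩ := exists_strictMono_diagonal infinite_univ
    (fun k _ N => ∀ x, ∃ l, Tendsto (fun n => dist (g n • x) (d k)) (atTop ⊓ 𝓟 N) (𝓝 l)) (by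
      intro k _ _ M _ hM
      let F : C(X, ℝ) := ⟨fun x => dist x (d k), by fun_prop⟩
      have hθ : StrictMono (Nat.nth (· ∈ M)) := Nat.nth_strictMono hM
      obtain ⟨ψ, hψ, hlim⟩ := mem_convergentTranslatesSubalgebra_of_not_independent (S := S) (F := F)
        (fun s hs => (h.tame F).2 ⟨_, fun n => ⟨s n, mem_univ _, rfl⟩, hs⟩)
        (fun n => g (Nat.nth (· ∈ M) n))
      have hχ : StrictMono fun n => Nat.nth (· ∈ M) (ψ n) := hθ.comp hψ
      refine ⟨range fun n => Nat.nth (· ∈ M) (ψ n),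
        range_subset_iff.mpr fun n => Nat.nth_mem_of_infinite hM _,
        infinite_range_of_injective hχ.injective, fun x => ?_⟩
      obtain ⟨l, hl⟩ := hlim x
      exact ⟨l, tendsto_atTop_inf_principal_range hχ hl⟩)
  have hdist : ∀ k x, ∃ l, Tendsto (fun n => dist (g (φ n) • x) (d k)) atTop (𝓝 l) := by
    intro k x
    obtain ⟨N, hN, hmem⟩ := hN k
    obtain ⟨l, hl⟩ := hN x
    refine ⟨l, hl.comp (tendsto_inf.mpr ⟨hφ.tendsto_atTop, tendsto_principal.mpr ?_⟩)⟩
    exact (eventually_gt_atTop k).mono hmem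
  have hlim : ∀ x, ∃ y : X, Tendsto (fun n => g (φ n) • x) atTop (𝓝 y) := by
    intro x
    have hcl : ∀ y, MapClusterPt y atTop (fun n => g (φ n) • x) → ∀ k l,
        Tendsto (fun n => dist (g (φ n) • x) (d k)) atTop (𝓝 l) → dist y (d k) = l := by
      intro y hy k l hl
      have : MapClusterPt (dist y (d k)) atTop fun n => dist (g (φ n) • x) (d k) :=
        hy.tendsto_comp (f := fun z => dist z (d k)) 
          ((by fun_prop : Continuous fun z : X => dist z (d k)).tendsto y)
      have hne : (𝓝 (dist y (d k)) ⊓ 𝓝 l).NeBot := NeBot.mono this (inf_le_inf_left _ hl)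
      exact eq_of_nhds_neBot hne
    obtain ⟨y, -, hy⟩ := isCompact_univ.exists_mapClusterPt (f := atTop)
      (u := fun n => g (φ n) • x) (by simp)
    refine ⟨y, isCompact_univ.tendsto_nhds_of_unique_mapClusterPt (by simp) fun y' _ hy' => ?_⟩
    -- Two cluster points have equal distances to a dense sequence, hence to every point, so they
    -- coincide.
    have heq : (fun z => dist y' z) = fun z => dist y z := by
      refine hd.equalizer (by fun_prop) (by fun_prop) (funext fun k => ?_)
      obtain ⟨l, hl⟩ := hdist k x
      exact (hcl y' hy' k l hl).trans (hcl y hy k l hl).symm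
    have := congrFun heq y
    simpa using this
  choose p hp using hlim
  exact ⟨φ, hφ, p, hp⟩

/-- The elements of `G₀` sending `x` to a given point are either absent or form a coset of the
finite stabiliser in `G₀`. -/
theorem finite_setOf_smul_mem {G X : Type*} [Group G] [MulAction G X] {G₀ : Subgroup G} {x : X}
    (hfin : ((G₀ : Set G) ∩ (MulAction.stabilizer G x : Set G)).Finite) {D : Set X}
    (hD : D.Finite) : {g | g ∈ G₀ ∧ g • x ∈ D}.Finite := by
  have : {g | g ∈ G₀ ∧ g • x ∈ D} = ⋃ d ∈ D, {g | g ∈ G₀ ∧ g • x = d} := by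
    ext g
    simp
  rw [this]
  refine hD.biUnion fun d _ => ?_
  rcases {g | g ∈ G₀ ∧ g • x = d}.eq_empty_or_nonempty with he | ⟨g₀, hg₀, hg₀x⟩
  · exact he ▸ finite_empty
  · refine (hfin.preimage (mul_right_injective g₀⁻¹).injOn).subset fun g hg => ?_
    refine ⟨G₀.mul_mem (G₀.inv_mem hg₀) hg.1, ?_⟩
    change (g₀⁻¹ * g) • x = x
    rw [mul_smul, hg.2, ← hg₀x, inv_smul_smul]

/-- A bounded sequence of functions has a subsequence converging on a given countable set. -/
theorem exists_subseq_tendsto_on_countable {X : Type*} {u : ℕ → X → ℝ} {B : ℝ}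
    (hB : ∀ n x, |u n x| ≤ B) {C : Set X} (hC : C.Countable) :
    ∃ φ : ℕ → ℕ, StrictMono φ ∧ ∀ x ∈ C, ∃ l, Tendsto (fun n => u (φ n) x) atTop (𝓝 l) := by
  have := hC.to_subtype
  obtain ⟨l, -, φ, hφ, hl⟩ := (isCompact_univ_pi (X := fun _ : C => ℝ) (s := fun _ => Icc (-B) B)
    fun _ => isCompact_Icc).tendsto_subseq (x := fun n (c : C) => u n c)
    fun n c _ => abs_le.mp (hB n c)
  exact ⟨φ, hφ, fun x hx => ⟨l ⟨x, hx⟩, tendsto_pi_nhds.mp hl ⟨x, hx⟩⟩⟩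

theorem isTameFamily_translates_of_finite_discSet {G X : Type*} [Group G] [TopologicalSpace G]
    [TopologicalSpace X] [CompactSpace X] [TopologicalSpace.MetrizableSpace X]
    [MulAction G X] [ContinuousConstSMul G X] {G₀ : Subgroup G} {f : X → ℝ}
    (htame : IsTameSystem G₀ X)
    (hcount : ∀ p ∈ envelopingSemigroup G X, ∀ x : X, (p ⁻¹' {x}).Countable)
    (hstab : ∀ x : X, ((G₀ : Set G) ∩ (MulAction.stabilizer G x : Set G)).Finite)
    (hbdd : ∃ B : ℝ, ∀ x, |f x| ≤ B) (hdisc : (discSet f).Finite) :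
    IsTameFamily (translates f (G₀ : Set G)) := by
  obtain ⟨B, hB⟩ := hbdd
  refine ⟨⟨B, ?_⟩, ?_⟩
  · rintro _ ⟨g, -, rfl⟩ x
    exact hB _
  rintro ⟨u, hu, hind⟩
  choose g hg hgu using hu
  have hgu' : ∀ n x, u n x = f (g n • x) := fun n x => (congrFun (hgu n) x).symm
  -- Independent terms are distinct, so each `x` is sent into the discontinuity set by only finitely
  -- many `g n`.
  have hginj : Function.Injective g := fun m n hmn => hind.injective (by rw [← hgu m, ← hgu n, hmn])
  have hcont : ∀ x, ∀ᶠ n in atTop, ContinuousAt (u n) x := by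
    intro x
    rw [← Nat.cofinite_eq_atTop]
    refine (((finite_setOf_smul_mem (hstab x) hdisc).preimage hginj.injOn)).subset fun n hn => ?_
    refine ⟨hg n, fun hcts => hn ?_⟩
    change ContinuousAt (u n) x
    rw [← hgu n]
    exact ContinuousAt.comp (f := fun x : X => g n • x) hcts (continuous_const_smul _).continuousAt
  obtain ⟨φ, hφ, p, hp⟩ := htame.exists_subseq_tendsto_smul fun n => (⟨g n, hg n⟩ : G₀)
  have hpE : p ∈ envelopingSemigroup G X :=
    mem_closure_of_tendsto (tendsto_pi_nhds.mpr hp)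
      (Eventually.of_forall fun n => ⟨g (φ n), rfl⟩)
  have hC : (p ⁻¹' discSet f).Countable := by
    rw [← biUnion_preimage_singleton]
    exact hdisc.countable.biUnion fun d _ => hcount p hpE d
  -- Continuity of `f` at `p x` says nothing over the discontinuities; there countability of the
  -- fibres yields convergence instead.
  obtain ⟨ψ, hψ, hlim⟩ := exists_subseq_tendsto_on_countable (u := fun n => u (φ n)) (B := B)
    (fun n x => by rw [hgu']; exact hB _) hC
  refine hind.not_forall_exists_tendsto hcont (hφ.comp hψ) fun x => ?_
  by_cases hx : x ∈ p ⁻¹' discSet f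
  · exact hlim x hx
  · refine ⟨f (p x), ?_⟩
    have hcts : ContinuousAt f (p x) := not_not.mp hx
    have := (hcts.tendsto.comp (hp x)).comp hψ.tendsto_atTop
    refine this.congr fun n => ?_
    exact (hgu' _ _).symm

/-! ### Compact groups and the final assembly -/

/-- A subgroup of a compact metrizable group acts tamely by left translations. -/
theorem isTameSystem_subgroup_of_compact_group {K : Type*} [Group K] [TopologicalSpace K]
    [IsTopologicalGroup K] [CompactSpace K] [TopologicalSpace.MetrizableSpace K]
    (H : Subgroup K) : IsTameSystem H K := by
  refine ⟨inferInstance, inferInstance, inferInstance, fun F => ⟨⟨‖F‖, ?_⟩, ?_⟩⟩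
  · rintro _ ⟨s, -, rfl⟩ y
    exact F.norm_coe_le_norm _
  · rintro ⟨u, hu, hui⟩
    choose s _ hs using hu
    have : u = fun n y => F (s n • y) := funext fun n => (hs n).symm
    rw [this] at hui
    refine not_independent_of_mem_convergentTranslatesSubalgebra (S := H) (fun s => ?_) s hui
    -- Convergence in `K` alone suffices: the limit `k` need not lie in `H`.
    obtain ⟨k, φ, hφ, hk⟩ := CompactSpace.tendsto_subseq fun n => (s n : K)
    exact ⟨φ, hφ, fun y => ⟨F (k * y), (F.continuous.tendsto _).comp (hk.mul_const y)⟩⟩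

/-- The translations form a continuous image of `K`, hence a compact and closed set, so every `p` is
an injective translation. -/
theorem countable_preimage_of_mem_envelopingSemigroup_group {K : Type*} [Group K]
    [TopologicalSpace K] [IsTopologicalGroup K] [CompactSpace K] [T2Space K] {p : K → K}
    (hp : p ∈ envelopingSemigroup K K) (x : K) : (p ⁻¹' {x}).Countable := by
  have hcl : IsClosed (range fun (s : K) (x : K) => s • x) :=
    (isCompact_range (continuous_pi fun x => by fun_prop)).isClosed
  rw [envelopingSemigroup, hcl.closure_eq] at hp
  obtain ⟨k, rfl⟩ := hp
  have hinj : Function.Injective fun x : K => k • x := mul_right_injective k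
  exact ((finite_singleton x).preimage hinj.injOn).countable

theorem finite_inter_stabilizer_self {K : Type*} [Group K] (H : Set K) (x : K) :
    (H ∩ (MulAction.stabilizer K x : Set K)).Finite := by
  refine (finite_singleton 1).subset fun g hg => ?_
  have : g * x = x := hg.2
  simpa using this

theorem theorem6p10 :
    -- compact metrizable `S`-spaces
    (∀ (S X : Type*) [Monoid S] [TopologicalSpace S] [ContinuousMul S]
        [TopologicalSpace X] [CompactSpace X] [TopologicalSpace.MetrizableSpace X]
        [MulAction S X] [ContinuousSMul S X] (S₀ : Subsemigroup S) (f : X → ℝ),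
        (∃ B : ℝ, ∀ x, |f x| ≤ B) →
        (∀ φ ∈ closure (translates f (S₀ : Set S)), IsBaireOne φ) →
        AlmostContinuous (translates f (S₀ : Set S)) →
        IsTameFamily (translates f (S₀ : Set S)) ∧
          ∀ (L : Type*) [Monoid L] [TopologicalSpace L] [DiscreteTopology L] (h : L →ₙ* S),
            (∀ l, h l ∈ S₀) → HasTameCodings (X := X) h f) ∧
    -- compact metrizable `G`-spaces
    (∀ (G X : Type*) [Group G] [TopologicalSpace G] [IsTopologicalGroup G]
        [TopologicalSpace X] [CompactSpace X] [TopologicalSpace.MetrizableSpace X]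
        [MulAction G X] [ContinuousSMul G X] (G₀ : Subgroup G) (f : X → ℝ),
        IsTameSystem G₀ X →
        (∀ p ∈ envelopingSemigroup G X, ∀ x : X, (p ⁻¹' {x}).Countable) →
        (∀ x : X, ((G₀ : Set G) ∩ (MulAction.stabilizer G x : Set G)).Finite) →
        (∃ B : ℝ, ∀ x, |f x| ≤ B) →
        (discSet f).Finite →
        IsTameFamily (translates f (G₀ : Set G)) ∧
          ∀ (L : Type*) [Monoid L] [TopologicalSpace L] [DiscreteTopology L] (h : L →ₙ* G),
            (∀ l, h l ∈ G₀) → HasTameCodings (X := X) h f) ∧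
    -- translations of a compact metrizable group `K` through a homomorphism `h : Γ → K`:
    -- the conditions of the previous part hold for `h(Γ)`, and the conclusions follow
    (∀ (Γ K : Type*) [Group Γ] [Group K] [TopologicalSpace K] [IsTopologicalGroup K]
        [CompactSpace K] [TopologicalSpace.MetrizableSpace K] (h : Γ →* K),
        (IsTameSystem h.range K ∧
          (∀ p ∈ envelopingSemigroup K K, ∀ x : K, (p ⁻¹' {x}).Countable) ∧
          (∀ x : K, ((h.range : Set K) ∩ (MulAction.stabilizer K x : Set K)).Finite)) ∧
        ∀ f : K → ℝ, (∃ B : ℝ, ∀ x, |f x| ≤ B) → (discSet f).Finite →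
          IsTameFamily (range fun (g : Γ) (x : K) => f (h g * x)) ∧
            ∀ (L : Type*) [Monoid L] [TopologicalSpace L] [DiscreteTopology L] (k : L →ₙ* Γ),
              HasTameCodings (X := K) (h.toMulHom.comp k) f) := by
  refine ⟨?_, ?_, ?_⟩
  · intro S X _ _ _ _ _ _ _ _ S₀ f hbdd hcl hF
    have hfam : IsTameFamily (translates f (S₀ : Set S)) := by
      obtain ⟨B, hB⟩ := hbdd
      refine hF.isTameFamily ⟨B, ?_⟩ hcl
      rintro _ ⟨s, -, rfl⟩ x
      exact hB _
    exact ⟨hfam, fun L _ _ _ h hh => hasTameCodings_of_isTameFamily hfam h hh⟩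
  · intro G X _ _ _ _ _ _ _ _ G₀ f htame hcount hstab hbdd hdisc
    have hfam := isTameFamily_translates_of_finite_discSet htame hcount hstab hbdd hdisc
    exact ⟨hfam, fun L _ _ _ h hh => hasTameCodings_of_isTameFamily hfam h hh⟩
  · intro Γ K _ _ _ _ _ _ h
    have htame := isTameSystem_subgroup_of_compact_group h.range
    have hcount : ∀ p ∈ envelopingSemigroup K K, ∀ x : K, (p ⁻¹' {x}).Countable :=
      fun p hp x => countable_preimage_of_mem_envelopingSemigroup_group hp x
    have hstab : ∀ x : K, ((h.range : Set K) ∩ (MulAction.stabilizer K x : Set K)).Finite :=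
      finite_inter_stabilizer_self _
    refine ⟨⟨htame, hcount, hstab⟩, fun f hbdd hdisc => ?_⟩
    have hfam := isTameFamily_translates_of_finite_discSet htame hcount hstab hbdd hdisc
    refine ⟨?_, fun L _ _ _ k => hasTameCodings_of_isTameFamily hfam _ fun l => ⟨k l, rfl⟩⟩
    convert hfam using 1
    rw [translates, MonoidHom.coe_range, ← range_comp]
    rfl
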